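/- Let $R$ be a unital, not necessarily associative ring, let $\sigma\colon R\to R$ be a ring automorphism, and let $\delta\colon R\to R$ be a $\sigma$-derivation, i.e. an additive map with $\delta(ab)=\sigma(a)\delta(b)+\delta(a)b$ for all $a,b\in R$. Let $R[X;\sigma,\delta]$ be the unital, non-associative Ore extension of $R$: its elements are the formal sums $\sum_{i\in\mathbb{N}}a_iX^i$ with $a_i\in R$ and finitely many $a_i$ nonzero, with coefficientwise addition and with the biadditive multiplication determined by \[ aX^m\cdot bX^n=\sum_{i=0}^{m}\bigl(a\cdot\pi_i^m(b)\bigr)X^{i+n}\qquad(a,b\in R,\ m,n\in\mathbb{N}), \] where $\pi_i^m$ is the sum of all $\binom{m}{i}$ compositions of $i$ copies of $\sigma$ and $m-i$ copies of $\delta$ in arbitrary order. Call a not necessarily associative ring $A$ right (left) noetherian if every right (left) ideal of $A$, i.e. every additive subgroup $I$ with $IA\subseteq I$ ($AI\subseteq I$), is finitely generated, i.e. is the intersection of all right (left) ideals containing some finite set; equivalently, if $A$ satisfies the ascending chain condition on right (left) ideals. If $R$ is right noetherian, then $R[X;\sigma,\delta]$ is right noetherian. If $R$ is left noetherian, then $R[X;\sigma,\delta]$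 is left noetherian. -/

import Mathlib

noncomputable section

namespace NonAssocOre

section Noetherian

variable {A : Type*} [NonUnitalNonAssocRing A]

/-- An additive subgroup of a (not necessarily associative) ring `A` is a right ideal if it is
closed under multiplication from the right by elements of `A`. -/
def IsRightIdeal (I : AddSubgroup A) : Prop :=
  ∀ x ∈ I, ∀ a : A, x * a ∈ I

/-- An additive subgroup of a (not necessarily associative) ring `A` is a left ideal if it is
closed under multiplication from the left by elements of `A`. -/
def IsLeftIdeal (I : AddSubgroup A) : Prop :=
  ∀ x ∈ I, ∀ a : A, a * x ∈ I

/-- The right ideal generated by `S`: the intersection of all right ideals containing `S`. -/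
def rightIdealSpan (S : Set A) : AddSubgroup A :=
  sInf {J : AddSubgroup A | IsRightIdeal J ∧ S ⊆ J}

/-- The left ideal generated by `S`: the intersection of all left ideals containing `S`. -/
def leftIdealSpan (S : Set A) : AddSubgroup A :=
  sInf {J : AddSubgroup A | IsLeftIdeal J ∧ S ⊆ J}

variable (A) in
/-- A (not necessarily associative) ring is right noetherian if every right ideal is finitely
generated. -/
def IsRightNoetherian : Prop :=
  ∀ I : AddSubgroup A, IsRightIdeal I → ∃ S : Set A, S.Finite ∧ I = rightIdealSpan S

variable (A) in
/-- A (not necessarily associative) ring is left noetherian if every left ideal is finitely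
generated. -/
def IsLeftNoetherian : Prop :=
  ∀ I : AddSubgroup A, IsLeftIdeal I → ∃ S : Set A, S.Finite ∧ I = leftIdealSpan S

end Noetherian

section Ore

variable {R : Type*} [NonAssocRing R]

/-- An additive map `δ` on `R` is a `σ`-derivation, for a unital endomorphism `σ` of `R`, if
`δ (a b) = σ a δ b + δ a b` for all `a` and `b`. -/
def IsSigmaDerivation (σ : R →+* R) (δ : R →+ R) : Prop :=
  ∀ a b : R, δ (a * b) = σ a * δ b + δ a * b

/-- `piFun σ δ m i` is the sum of all `m.choose i` compositions of `i` copies of `σ` and `m - i`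
copies of `δ` in arbitrary order: the set `s` of size `i` records the positions of `σ` in the word.
The word is composed from left to right. The sum is empty if `m < i`. -/
def piFun (σ δ : R →+ R) (m i : ℕ) : R →+ R :=
  ∑ s ∈ Finset.powersetCard i (Finset.univ : Finset (Fin m)),
    (List.ofFn fun j : Fin m => if j ∈ s then σ else δ).foldr AddMonoidHom.comp (AddMonoidHom.id R)

/-- The underlying additive group of the Ore extension `R[X; σ, δ]`: formal sums `∑ aᵢ Xⁱ` with
finitely many nonzero coefficients `aᵢ`, written on the left; `Finsupp.single m a` is `a Xᵐ`. -/
@[nolint unusedArguments]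
def OreExtension (_σ _δ : R →+ R) : Type _ := ℕ →₀ R

namespace OreExtension

variable (σ δ : R →+ R)

instance : AddCommGroup (OreExtension σ δ) :=
  inferInstanceAs (AddCommGroup (ℕ →₀ R))

/-- The monomial `a Xᵐ`. -/
def monomial (m : ℕ) : R →+ OreExtension σ δ := Finsupp.singleAddHom m

variable {σ δ} in
/-- The coefficient `aᵢ` of `∑ aᵢ Xⁱ`. -/
def coeff (i : ℕ) : OreExtension σ δ →+ R := Finsupp.applyAddHom i

variable {σ δ} in
/-- The additive map on `R[X; σ, δ]` which sends `a Xᵐ` to `f m a`. -/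
def lift {M : Type*} [AddCommMonoid M] (f : ℕ → R →+ M) : OreExtension σ δ →+ M :=
  Finsupp.liftAddHom f

theorem lift_monomial {M : Type*} [AddCommMonoid M] (f : ℕ → R →+ M) (m : ℕ) (a : R) :
    lift f (monomial σ δ m a) = f m a :=
  Finsupp.liftAddHom_apply_single f m a

theorem coeff_monomial (i m : ℕ) (a : R) :
    coeff i (monomial σ δ m a) = if m = i then a else 0 :=
  Finsupp.single_apply

/-- The product of monomials `a Xᵐ · b Xⁿ = ∑ i, (a · πᵢᵐ(b)) Xⁱ⁺ⁿ`, as a biadditive map of the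
coefficients `a` and `b`. -/
def monomialMul (m n : ℕ) : R →+ R →+ OreExtension σ δ :=
  AddMonoidHom.mk' (fun a => ∑ i ∈ Finset.range (m + 1),
    (monomial σ δ (i + n)).comp ((AddMonoidHom.mulLeft a).comp (piFun σ δ m i)))
    (by
      intro a b
      ext x
      simp [add_mul, Finset.sum_add_distrib])

/-- The multiplication of `R[X; σ, δ]`, the biadditive extension of the product of monomials. -/
def mulHom : OreExtension σ δ →+ OreExtension σ δ →+ OreExtension σ δ :=
  lift fun m => (lift fun n => (monomialMul σ δ m n).flip).flip

instance : Mul (OreExtension σ δ) := ⟨fun p q => mulHom σ δ p q⟩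

instance : NonUnitalNonAssocRing (OreExtension σ δ) where
  left_distrib p q r := map_add (mulHom σ δ p) q r
  right_distrib p q r := by
    change mulHom σ δ (p + q) r = mulHom σ δ p r + mulHom σ δ q r
    rw [map_add, AddMonoidHom.add_apply]
  zero_mul p := by
    change mulHom σ δ 0 p = 0
    rw [map_zero, AddMonoidHom.zero_apply]
  mul_zero p := map_zero (mulHom σ δ p)

/-- The unit `1 X⁰` (it is a unit for the multiplication if `σ 1 = 1` and `δ 1 = 0`). -/
instance : One (OreExtension σ δ) := ⟨monomial σ δ 0 1⟩

/-- The defining formula for the product of two monomials. -/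
theorem monomial_mul_monomial (m n : ℕ) (a b : R) :
    monomial σ δ m a * monomial σ δ n b =
      ∑ i ∈ Finset.range (m + 1), monomial σ δ (i + n) (a * piFun σ δ m i b) := by
  change mulHom σ δ (monomial σ δ m a) (monomial σ δ n b) = _
  rw [mulHom, lift_monomial, AddMonoidHom.flip_apply, lift_monomial, AddMonoidHom.flip_apply]
  simp [monomialMul]

theorem induction_monomial {P : OreExtension σ δ → Prop} (p : OreExtension σ δ)
    (h0 : P 0) (hadd : ∀ p q, P p → P q → P (p + q)) (hm : ∀ m a, P (monomial σ δ m a)) : P p :=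
  Finsupp.induction_linear (motive := P) p h0 hadd hm

theorem one_mul' (p : OreExtension σ δ) : 1 * p = p := by
  induction p using induction_monomial with
  | h0 => exact mul_zero _
  | hadd p q hp hq => rw [mul_add, hp, hq]
  | hm n b =>
    change monomial σ δ 0 1 * _ = _
    rw [monomial_mul_monomial]
    simp [piFun]

theorem foldr_comp_apply_one (σ : R →+* R) (δ : R →+ R) (hδ : IsSigmaDerivation σ δ) (m : ℕ)
    (s : Fin m → Prop) [DecidablePred s] :
    (List.ofFn fun j : Fin m => if s j then (σ : R →+ R) else δ).foldr AddMonoidHom.comp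
      (AddMonoidHom.id R) 1 = if ∀ j, s j then 1 else 0 := by
  have h1 : δ 1 = 0 := by simpa using hδ 1 1
  induction m with
  | zero => simp
  | succ m ih =>
    rw [List.ofFn_succ, List.foldr_cons, AddMonoidHom.comp_apply, ih]
    by_cases h0 : s 0 <;> by_cases h : ∀ j : Fin m, s j.succ <;>
      simp [Fin.forall_fin_succ, h0, h, h1]

theorem piFun_apply_one (σ : R →+* R) (δ : R →+ R) (hδ : IsSigmaDerivation σ δ) (m i : ℕ) :
    piFun (σ : R →+ R) δ m i 1 = if i = m then 1 else 0 := by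
  have key : ∀ s : Finset (Fin m),
      (List.ofFn fun j : Fin m => if j ∈ s then (σ : R →+ R) else δ).foldr AddMonoidHom.comp
        (AddMonoidHom.id R) 1 = if s = Finset.univ then 1 else 0 := fun s => by
    rw [foldr_comp_apply_one σ δ hδ m (fun j => j ∈ s)]
    simp [Finset.eq_univ_iff_forall]
  rw [piFun, AddMonoidHom.finsetSum_apply]
  refine (Finset.sum_congr rfl fun s _ => key s).trans ?_
  rw [Finset.sum_ite_eq']
  simp [Finset.mem_powersetCard, eq_comm]

theorem mul_one' (σ : R →+* R) (δ : R →+ R) (hδ : IsSigmaDerivation σ δ)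
    (p : OreExtension (σ : R →+ R) δ) : p * 1 = p := by
  induction p using induction_monomial with
  | h0 => exact zero_mul _
  | hadd p q hp hq => rw [add_mul, hp, hq]
  | hm m a =>
    change _ * monomial _ δ 0 1 = _
    rw [monomial_mul_monomial]
    simp [piFun_apply_one σ δ hδ, Finset.sum_ite_eq', apply_ite]

/-- If `δ` is a `σ`-derivation, then `R[X; σ, δ]` is a unital, non-associative ring. -/
abbrev nonAssocRing (σ : R →+* R) (δ : R →+ R) (hδ : IsSigmaDerivation σ δ) :
    NonAssocRing (OreExtension (σ : R →+ R) δ) where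
  one_mul := one_mul' _ _
  mul_one := mul_one' σ δ hδ

end OreExtension

end Ore

end NonAssocOre

end

namespace NonAssocOre

/-! This is Hilbert's basis theorem. Leading coefficients of a one-sided ideal `I` in degree at most
`m` form `lead I m`, and ideals `I ≤ J` with equal `lead` in every degree coincide
(`le_of_lead_le`). Only multiplication of elements of `I` by constants and by `X` is needed, so
associativity plays no role. Right ideals: right multiplication by `b` turns the leading coefficient
`r` into `r * σ^[m] b`, and by `X` shifts coefficients, so the `lead I m` are an increasing chain of
right ideals. Left ideals: left multiplication by `X` turns `r` into `σ r`, so the chain is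
increasing only after untwisting, that is, for the preimages of `lead I m` under `σ^[m]`.
`finitelyGenerated_of_lead` covers both cases. -/

theorem isRightIdeal_sInf {A : Type*} [NonUnitalNonAssocRing A] (s : Set (AddSubgroup A))
    (hs : ∀ J ∈ s, IsRightIdeal J) : IsRightIdeal (sInf s) := by
  intro x hx a
  rw [AddSubgroup.mem_sInf] at hx ⊢
  exact fun J hJ => hs J hJ x (hx J hJ) a

theorem isLeftIdeal_sInf {A : Type*} [NonUnitalNonAssocRing A] (s : Set (AddSubgroup A))
    (hs : ∀ J ∈ s, IsLeftIdeal J) : IsLeftIdeal (sInf s) := by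
  intro x hx a
  rw [AddSubgroup.mem_sInf] at hx ⊢
  exact fun J hJ => hs J hJ x (hx J hJ) a

theorem isRightIdeal_iSup {A : Type*} [NonUnitalNonAssocRing A] (f : ℕ → AddSubgroup A)
    (hf : Monotone f) (h : ∀ n, IsRightIdeal (f n)) : IsRightIdeal (⨆ n, f n) := by
  intro x hx a
  rw [AddSubgroup.mem_iSup_of_directed hf.directed_le] at hx ⊢
  exact hx.imp fun n hn => h n x hn a

theorem isLeftIdeal_iSup {A : Type*} [NonUnitalNonAssocRing A] (f : ℕ → AddSubgroup A)
    (hf : Monotone f) (h : ∀ n, IsLeftIdeal (f n)) : IsLeftIdeal (⨆ n, f n) := by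
  intro x hx a
  rw [AddSubgroup.mem_iSup_of_directed hf.directed_le] at hx ⊢
  exact hx.imp fun n hn => h n x hn a

/-- If every subgroup satisfying `P` is generated by a finite set, then ascending chains of such
subgroups become stationary. -/
theorem exists_forall_le_of_finitelyGenerated {A : Type*} [AddCommGroup A]
    {P : AddSubgroup A → Prop}
    (hfg : ∀ I, P I → ∃ S : Set A, S.Finite ∧ I = sInf {J | P J ∧ S ⊆ J})
    (hsup : ∀ f : ℕ → AddSubgroup A, Monotone f → (∀ n, P (f n)) → P (⨆ n, f n))
    (f : ℕ → AddSubgroup A) (hf : Monotone f) (h : ∀ n, P (f n)) :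
    ∃ N, ∀ n, f n ≤ f N := by
  obtain ⟨S, hS, hgen⟩ := hfg _ (hsup f hf h)
  have hmem : ∀ x ∈ S, ∃ n, x ∈ f n := fun x hx => by
    rw [← AddSubgroup.mem_iSup_of_directed hf.directed_le, hgen, AddSubgroup.mem_sInf]
    exact fun J hJ => hJ.2 hx
  choose! k hk using hmem
  -- The finitely many generators of the union all lie in one term of the chain.
  obtain ⟨N, hN⟩ := (hS.image k).bddAbove
  refine ⟨N, fun n => (le_iSup f n).trans ?_⟩
  rw [hgen]
  exact sInf_le ⟨h N, fun x hx => hf (hN (Set.mem_image_of_mem k hx)) (hk x hx)⟩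

theorem piFun_self_apply {R : Type*} [NonAssocRing R] (σ δ : R →+ R) (m : ℕ) (b : R) :
    piFun σ δ m m b = σ^[m] b := by
  have h : Finset.powersetCard m (Finset.univ : Finset (Fin m)) = {Finset.univ} := by
    simpa using Finset.powersetCard_self (Finset.univ : Finset (Fin m))
  rw [piFun, h, Finset.sum_singleton]
  simp only [Finset.mem_univ, if_true, List.ofFn_const]
  clear h
  induction m with
  | zero => rfl
  | succ m ih =>
    rw [List.replicate_succ, List.foldr_cons, AddMonoidHom.comp_apply,
      Function.iterate_succ_apply', ih]

theorem piFun_one_zero {R : Type*} [NonAssocRing R] (σ δ : R →+ R) : piFun σ δ 1 0 = δ := by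
  ext b
  simp [piFun]

theorem iterate_ringEquiv_mul {R : Type*} [NonAssocRing R] (σ : R ≃+* R) (m : ℕ) (a b : R) :
    σ^[m] (a * b) = σ^[m] a * σ^[m] b :=
  Function.Semiconj₂.iterate (f := σ) (op := (· * ·)) (map_mul σ) m a b

namespace OreExtension

/-! ### Leading coefficients and the basis argument -/

section Lead

variable {R : Type*} [NonAssocRing R] {σ δ : R →+ R}

@[ext]
theorem ext_coeff {p q : OreExtension σ δ} (h : ∀ i, coeff i p = coeff i q) : p = q :=
  Finsupp.ext h

theorem exists_forall_lt_coeff_eq_zero (p : OreExtension σ δ) :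
    ∃ m, ∀ i, m ≤ i → coeff i p = 0 := by
  induction p using induction_monomial with
  | h0 => exact ⟨0, fun i _ => map_zero _⟩
  | hadd p q hp hq =>
    obtain ⟨m, hm⟩ := hp
    obtain ⟨n, hn⟩ := hq
    exact ⟨max m n, fun i hi => by
      rw [map_add, hm i (le_of_max_le_left hi), hn i (le_of_max_le_right hi), add_zero]⟩
  | hm m a => exact ⟨m + 1, fun i hi => by rw [coeff_monomial, if_neg (by omega)]⟩

theorem eq_sum_monomial {p : OreExtension σ δ} {m : ℕ} (hp : ∀ i, m < i → coeff i p = 0) :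
    p = ∑ i ∈ Finset.range (m + 1), monomial σ δ i (coeff i p) := by
  ext j
  simp only [map_sum, coeff_monomial, Finset.sum_ite_eq', Finset.mem_range]
  split_ifs with h
  · rfl
  · exact hp j (by omega)

/-- The additive group of the coefficients at `Xᵐ` of the elements of `I` of degree at most `m`. -/
noncomputable def lead (I : AddSubgroup (OreExtension σ δ)) (m : ℕ) : AddSubgroup R :=
  (I ⊓ ⨅ i, ⨅ _ : m < i, (coeff i).ker).map (coeff m)

theorem mem_lead {I : AddSubgroup (OreExtension σ δ)} {m : ℕ} {r : R} :
    r ∈ lead I m ↔ ∃ p ∈ I, (∀ i, m < i → coeff i p = 0) ∧ coeff m p = r := by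
  simp [lead, AddSubgroup.mem_iInf, AddMonoidHom.mem_ker, and_assoc]

/-- Subtracting from `p ∈ J` an element of `I` with the same leading coefficient lowers the degree;
induct. -/
theorem le_of_lead_le {I J : AddSubgroup (OreExtension σ δ)} (hIJ : I ≤ J)
    (h : ∀ m, lead J m ≤ lead I m) : J ≤ I := by
  have key : ∀ m, ∀ p ∈ J, (∀ i, m ≤ i → coeff i p = 0) → p ∈ I := by
    intro m
    induction m with
    | zero =>
      intro p _ hp
      rw [show p = 0 from ext_coeff fun i => by rw [hp i (Nat.zero_le i), map_zero]]
      exact zero_mem I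
    | succ m ih =>
      intro p hpJ hp
      obtain ⟨q, hqI, hq, hqm⟩ := mem_lead.1 (h m (mem_lead.2 ⟨p, hpJ, hp, rfl⟩))
      rw [← sub_add_cancel p q]
      refine add_mem (ih _ (sub_mem hpJ (hIJ hqI)) fun i hi => ?_) hqI
      rw [map_sub]
      rcases hi.eq_or_lt with rfl | hi
      · rw [hqm, sub_self]
      · rw [hp i hi, hq i hi, sub_self]
  intro p hp
  obtain ⟨m, hm⟩ := exists_forall_lt_coeff_eq_zero p
  exact key m p hp hm

/-- Hilbert's basis theorem for families `P` and `Q` of additive subgroups of `R` and of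
`R[X; σ, δ]`, where the leading coefficients are twisted by surjective maps `T m`. -/
theorem finitelyGenerated_of_lead {P : AddSubgroup R → Prop}
    {Q : AddSubgroup (OreExtension σ δ) → Prop} (T : ℕ → R →+ R)
    (hT : ∀ m, Function.Surjective (T m))
    (hfg : ∀ I, P I → ∃ S : Set R, S.Finite ∧ I = sInf {J | P J ∧ S ⊆ J})
    (hsup : ∀ f : ℕ → AddSubgroup R, Monotone f → (∀ n, P (f n)) → P (⨆ n, f n))
    (hinf : ∀ s : Set (AddSubgroup (OreExtension σ δ)), (∀ J ∈ s, Q J) → Q (sInf s))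
    (hlead : ∀ I, Q I → ∀ m, P ((lead I m).comap (T m)))
    (hmono : ∀ I, Q I → Monotone fun m => (lead I m).comap (T m))
    (J : AddSubgroup (OreExtension σ δ)) (hJ : Q J) :
    ∃ S : Set (OreExtension σ δ), S.Finite ∧ J = sInf {K | Q K ∧ S ⊆ K} := by
  obtain ⟨N, hN⟩ := exists_forall_le_of_finitelyGenerated hfg hsup _ (hmono J hJ) (hlead J hJ)
  choose F hF hgen using fun m => hfg _ (hlead J hJ m)
  have hmem : ∀ m, ∀ r ∈ F m, ∃ p ∈ J, (∀ i, m < i → coeff i p = 0) ∧ coeff m p = T m r := by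
    intro m r hr
    rw [← mem_lead, ← AddSubgroup.mem_comap, hgen m, AddSubgroup.mem_sInf]
    exact fun K hK => hK.2 hr
  choose! g hgJ hg hgm using hmem
  -- Lifts to `J` of the generators in degrees up to `N`, where the untwisted chain becomes
  -- stationary.
  set U : Set (OreExtension σ δ) := ⋃ m ∈ Set.Iic N, g m '' F m with hU
  have hUJ : U ⊆ J := by
    simp only [hU, Set.iUnion_subset_iff, Set.image_subset_iff]
    exact fun m _ r hr => hgJ m r hr
  refine ⟨U, (Set.finite_Iic N).biUnion fun m _ => (hF m).image _, ?_⟩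
  set I := sInf {K | Q K ∧ U ⊆ K}
  have hI : Q I := hinf _ fun K hK => hK.1
  have hUI : U ⊆ I := fun p hp => AddSubgroup.mem_sInf.2 fun K hK => hK.2 hp
  have hIJ : I ≤ J := sInf_le ⟨hJ, hUJ⟩
  have hle : ∀ m ≤ N, (lead J m).comap (T m) ≤ (lead I m).comap (T m) := fun m hm => by
    rw [hgen m]
    exact sInf_le ⟨hlead I hI m, fun r hr => mem_lead.2
      ⟨g m r, hUI (Set.mem_biUnion hm (Set.mem_image_of_mem _ hr)), hg m r hr, hgm m r hr⟩⟩
  refine le_antisymm (le_of_lead_le hIJ fun m r hr => ?_) hIJ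
  obtain ⟨s, rfl⟩ := hT m r
  rcases le_total m N with hm | hm
  · exact hle m hm hr
  -- Above `N`, descend to degree `N` by stationarity for `J`, pass to `I` there, and climb back by
  -- monotonicity for `I`.
  · exact hmono I hI hm (hle N le_rfl (hN m hr))

/-! ### Products with constants and with `X` -/

theorem coeff_monomial_zero_mul (b : R) (p : OreExtension σ δ) (j : ℕ) :
    coeff j (monomial σ δ 0 b * p) = b * coeff j p := by
  induction p using induction_monomial with
  | h0 => simp
  | hadd p q hp hq => rw [mul_add, map_add, map_add, hp, hq, mul_add]
  | hm n a =>
    rw [monomial_mul_monomial]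
    simp [piFun_self_apply, coeff_monomial]

theorem coeff_X_mul (p : OreExtension σ δ) (j : ℕ) :
    coeff (j + 1) (monomial σ δ 1 1 * p) = σ (coeff j p) + δ (coeff (j + 1) p) := by
  induction p using induction_monomial with
  | h0 => simp
  | hadd p q hp hq =>
    rw [mul_add, map_add, map_add, hp, hq, map_add, map_add, map_add]
    abel
  | hm n a =>
    rw [monomial_mul_monomial, Finset.sum_range_succ, Finset.sum_range_one, piFun_one_zero,
      piFun_self_apply, map_add, coeff_monomial, coeff_monomial, coeff_monomial, coeff_monomial,
      add_comm]
    simp [add_comm 1 n, apply_ite σ, apply_ite δ]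

/-- In degree `j ≥ m` only `piFun σ δ j j`, which is `σ^[j]`, contributes. Allowing `j > m` also
yields the degree bound for the product. -/
theorem coeff_mul_monomial_zero {p : OreExtension σ δ} {m j : ℕ}
    (hp : ∀ i, m < i → coeff i p = 0) (hj : m ≤ j) (b : R) :
    coeff j (p * monomial σ δ 0 b) = coeff j p * σ^[j] b := by
  have h : ∀ i ∈ Finset.range (m + 1), coeff j (monomial σ δ i (coeff i p) * monomial σ δ 0 b) =
      if i = j then coeff j p * σ^[j] b else 0 := by
    intro i hi
    rw [Finset.mem_range] at hi
    simp only [monomial_mul_monomial, map_sum, coeff_monomial, add_zero, Finset.sum_ite_eq',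
      Finset.mem_range]
    by_cases hij : i = j
    · subst hij
      simp [piFun_self_apply]
    · rw [if_neg (by omega), if_neg hij]
  conv_lhs => rw [eq_sum_monomial hp]
  rw [Finset.sum_mul, map_sum, Finset.sum_congr rfl h, Finset.sum_ite_eq']
  split_ifs with hjm
  · rfl
  · rw [hp j (by rw [Finset.mem_range] at hjm; omega), zero_mul]

end Lead

/-- Since `δ 1 = 0`, all words containing `δ` kill `1`, so right multiplication by `X` is a pure
shift. -/
theorem coeff_mul_X {R : Type*} [NonAssocRing R] {σ : R →+* R} {δ : R →+ R}
    (hδ : IsSigmaDerivation σ δ) (p : OreExtension (σ : R →+ R) δ) (j : ℕ) :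
    coeff (j + 1) (p * monomial (σ : R →+ R) δ 1 1) = coeff j p := by
  induction p using induction_monomial with
  | h0 => simp
  | hadd p q hp hq => rw [add_mul, map_add, map_add, hp, hq]
  | hm n a =>
    rw [monomial_mul_monomial]
    simp [piFun_apply_one σ δ hδ, coeff_monomial,
      apply_ite (monomial (σ : R →+ R) δ _)]

variable {R : Type*} [NonAssocRing R] {σ : R ≃+* R} {δ : R →+ R}

theorem isRightIdeal_lead {I : AddSubgroup (OreExtension ((σ : R →+* R) : R →+ R) δ)}
    (hI : IsRightIdeal I) (m : ℕ) : IsRightIdeal (lead I m) := by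
  intro r hr a
  obtain ⟨p, hpI, hp, rfl⟩ := mem_lead.1 hr
  -- Surjectivity of `σ` is what makes every `a` a possible right factor.
  obtain ⟨b, rfl⟩ := σ.surjective.iterate m a
  refine mem_lead.2 ⟨p * monomial _ _ 0 b, hI p hpI _, fun i hi => ?_,
    coeff_mul_monomial_zero hp le_rfl b⟩
  rw [coeff_mul_monomial_zero hp hi.le, hp i hi, zero_mul]

theorem monotone_lead (hδ : IsSigmaDerivation (σ : R →+* R) δ)
    {I : AddSubgroup (OreExtension ((σ : R →+* R) : R →+ R) δ)}
    (hI : IsRightIdeal I) : Monotone (lead I) := by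
  refine monotone_nat_of_le_succ fun m r hr => ?_
  obtain ⟨p, hpI, hp, rfl⟩ := mem_lead.1 hr
  refine mem_lead.2 ⟨p * monomial _ _ 1 1, hI p hpI _, fun i hi => ?_, coeff_mul_X hδ p m⟩
  obtain ⟨i, rfl⟩ := Nat.exists_eq_add_of_lt (Nat.zero_lt_of_lt hi)
  rw [zero_add, coeff_mul_X hδ]
  exact hp i (by omega)

theorem isLeftIdeal_lead {σ δ : R →+ R} {I : AddSubgroup (OreExtension σ δ)}
    (hI : IsLeftIdeal I) (m : ℕ) : IsLeftIdeal (lead I m) := by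
  intro r hr a
  obtain ⟨p, hpI, hp, rfl⟩ := mem_lead.1 hr
  refine mem_lead.2 ⟨monomial _ _ 0 a * p, hI p hpI _, fun i hi => ?_,
    coeff_monomial_zero_mul a p m⟩
  rw [coeff_monomial_zero_mul, hp i hi, mul_zero]

theorem map_mem_lead_succ {σ δ : R →+ R} {I : AddSubgroup (OreExtension σ δ)}
    (hI : IsLeftIdeal I) {m : ℕ} {r : R} (hr : r ∈ lead I m) : σ r ∈ lead I (m + 1) := by
  obtain ⟨p, hpI, hp, rfl⟩ := mem_lead.1 hr
  refine mem_lead.2 ⟨monomial _ _ 1 1 * p, hI p hpI _, fun i hi => ?_, ?_⟩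
  · obtain ⟨i, rfl⟩ := Nat.exists_eq_add_of_lt (Nat.zero_lt_of_lt hi)
    rw [zero_add, coeff_X_mul, hp i (by omega), hp (i + 1) (by omega), map_zero, map_zero,
      add_zero]
  · rw [coeff_X_mul, hp (m + 1) (by omega), map_zero, add_zero]

end OreExtension

end NonAssocOre

open NonAssocOre OreExtension in
theorem mainTheorem2 {R : Type*} [NonAssocRing R] (σ : R ≃+* R) (δ : R →+ R)
    (hδ : NonAssocOre.IsSigmaDerivation (σ : R →+* R) δ) :
    (NonAssocOre.IsRightNoetherian R →
      NonAssocOre.IsRightNoetherian (NonAssocOre.OreExtension ((σ : R →+* R) : R →+ R) δ)) ∧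
    (NonAssocOre.IsLeftNoetherian R →
      NonAssocOre.IsLeftNoetherian (NonAssocOre.OreExtension ((σ : R →+* R) : R →+ R) δ)) := by
  constructor
  · intro hR
    exact finitelyGenerated_of_lead (fun _ => AddMonoidHom.id R) (fun _ => Function.surjective_id)
      hR isRightIdeal_iSup isRightIdeal_sInf (fun I hI m => isRightIdeal_lead hI m)
      (fun I hI => monotone_lead hδ hI)
  · intro hR
    -- Pulling back along `σ^[m]` cancels the twist; it preserves left ideals because `σ` is
    -- multiplicative.
    let T : ℕ → R →+ R := fun m => AddMonoidHom.mk' σ^[m] (iterate_map_add σ m)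
    have hT : ∀ m r, T m r = σ^[m] r := fun _ _ => rfl
    refine finitelyGenerated_of_lead T (fun m r => ?_) hR isLeftIdeal_iSup isLeftIdeal_sInf
      (fun I hI m x hx a => ?_) (fun I hI => monotone_nat_of_le_succ fun m x hx => ?_)
    · simpa only [hT] using σ.surjective.iterate m r
    · change σ^[_] _ ∈ lead I _ at hx ⊢
      rw [iterate_ringEquiv_mul]
      exact isLeftIdeal_lead hI m _ hx _
    · change σ^[_] _ ∈ lead I _ at hx ⊢
      rw [Function.iterate_succ_apply']
      exact map_mem_lead_succ hI hx
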